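/- Let $\mathbb{K}$ be a field and let $G$ be a finite simple graph. Its toric ideal $I_G\subseteq \mathbb{K}[E(G)]$ is the kernel of the $\mathbb{K}$-algebra homomorphism $\mathbb{K}[E(G)]\to\mathbb{K}[V(G)]$ that sends each edge $\{a,b\}$ (viewed as an indeterminate) to the product $ab$. Let $y$ be an indeterminate of a polynomial ring $R$ over $\mathbb{K}$ in finitely many indeterminates, and let $I\subseteq R$ be an ideal. For $f\in R$, let $\mathrm{init}_y f$ be the sum of all terms of $f$ having the highest power of $y$; a monomial order $<$ is $y$-compatible if $\mathrm{init}_<f=\mathrm{init}_<(\mathrm{init}_yf)$ for all $f\in R$. Let $\{y^{d_i}q_i+r_i \mid 1\le i\le s\}$ be a Gröbner basis of $I$ with respect to a $y$-compatible monomial order, where $y\nmid q_i$ and $\mathrm{init}_y(y^{d_i}q_i+r_i)=y^{d_i}q_i$ for all $i$, and put $C_{y,I}=\langle q_i \mid 1\le i\le s\rangle$ and $N_{y,I}=\langle q_i \mid d_i=0\rangle$. These data define a Knutson–Miller–Yong (KMY) decomposition $\sqrt{\langle \mathrm{init}_y f \mid f\in I\rangle}=\sqrt{C_{y,I}}\cap\sqrt{N_{y,I}+\langle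 y\rangle}$ of $I$ with respect to $y$. It is degenerate if $\sqrt{C_{y,I}}=\sqrt{N_{y,I}}$ or $C_{y,I}=\langle 1\rangle$, and nondegenerate otherwise. **Theorem.** Suppose that $G$ is a non-bipartite finite simple graph and that $y\in E(G)$ defines a nondegenerate KMY decomposition of $I_G$. Then $G\setminus y$ is not bipartite. Furthermore, if $G$ is connected, then there exist an integer $k\ge 0$ and a sequence of distinct edges $e_1,\dots,e_k$ of $G$ such that the graph $G_i:=G\setminus\{e_1,\dots,e_i\}$ (obtained by deleting the edges $e_1,\dots,e_i$ and keeping all vertices) is connected and non-bipartite for all $1\le i\le k$, $I_{G_k}=\langle 0\rangle$, and $\mathrm{height}(I_G)=k$. -/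

import Mathlib

universe u v w

open MvPolynomial

noncomputable section

namespace KMY

section Polynomial

variable {K : Type v} [Field K] {σ : Type u}

/-- The initial `y`-form of `f`: the sum of all terms of `f` having the highest power of the
variable `y` (and `0` for `f = 0`). -/
def initForm (y : σ) (f : MvPolynomial σ K) : MvPolynomial σ K :=
  open Classical in
  ∑ a ∈ f.support with a y = f.degreeOf y, monomial a (f.coeff a)

/-- A monomial order is `y`-compatible if `f` and its initial `y`-form have the same
initial term, for every polynomial `f`. -/
def IsCompatible (K : Type v) [Field K] (m : MonomialOrder.{u, w} σ) (y : σ) : Prop :=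
  ∀ f : MvPolynomial σ K, m.leadingTerm f = m.leadingTerm (initForm y f)

/-- The family `g` (of elements of `I`) is a Gröbner basis of `I`: the initial terms of its
members generate the initial ideal of `I`. -/
def IsGroebnerBasis (m : MonomialOrder.{u, w} σ) (I : Ideal (MvPolynomial σ K))
    {ι : Type*} (g : ι → MvPolynomial σ K) : Prop :=
  (∀ i, g i ∈ I) ∧
    Ideal.span (Set.range fun i => m.leadingTerm (g i)) =
      Ideal.span (m.leadingTerm '' (I : Set (MvPolynomial σ K)))

/-- The data defining a Knutson-Miller-Yong decomposition of the ideal `I` with respect to the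
variable `y`: a finite Gröbner basis `y ^ dᵢ * qᵢ + rᵢ` of `I` for a `y`-compatible monomial
order, where `y` does not divide `qᵢ` and the initial `y`-form of `y ^ dᵢ * qᵢ + rᵢ` is
`y ^ dᵢ * qᵢ`. -/
structure Decomposition (m : MonomialOrder.{u, w} σ) (y : σ) (I : Ideal (MvPolynomial σ K)) where
  /-- the number of elements of the Gröbner basis -/
  size : ℕ
  /-- the exponents of `y` -/
  d : Fin size → ℕ
  /-- the cofactors of the powers of `y` in the initial `y`-forms -/
  q : Fin size → MvPolynomial σ K
  /-- the remainders -/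
  r : Fin size → MvPolynomial σ K
  compatible : IsCompatible K m y
  groebner : IsGroebnerBasis m I fun i => X y ^ d i * q i + r i
  not_dvd : ∀ i, ¬ X y ∣ q i
  initForm_eq : ∀ i, initForm y (X y ^ d i * q i + r i) = X y ^ d i * q i

namespace Decomposition

variable {m : MonomialOrder.{u, w} σ} {y : σ} {I : Ideal (MvPolynomial σ K)}

/-- The ideal `C_{y,I}`, generated by all the `qᵢ`. -/
def idealC (D : Decomposition m y I) : Ideal (MvPolynomial σ K) :=
  Ideal.span (Set.range D.q)

/-- The ideal `N_{y,I}`, generated by the `qᵢ` with `dᵢ = 0`. -/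
def idealN (D : Decomposition m y I) : Ideal (MvPolynomial σ K) :=
  Ideal.span (D.q '' {i | D.d i = 0})

/-- The decomposition is degenerate if `√C = √N` or `C` is the unit ideal. -/
def IsDegenerate (D : Decomposition m y I) : Prop :=
  D.idealC.radical = D.idealN.radical ∨ D.idealC = ⊤

/-- The decomposition is nondegenerate if it is not degenerate. -/
def IsNondegenerate (D : Decomposition m y I) : Prop :=
  ¬ D.IsDegenerate

end Decomposition

end Polynomial

section Graph

variable (K : Type v) [Field K] {V : Type u}

/-- The `K`-algebra homomorphism `K[E(G)] → K[V(G)]` sending the variable of an edge `{a, b}` to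
the product of the variables of `a` and `b`. -/
def edgeHom (G : SimpleGraph V) : MvPolynomial G.edgeSet K →ₐ[K] MvPolynomial V K :=
  aeval fun e : G.edgeSet => ((e : Sym2 V).map fun a => (X a : MvPolynomial V K)).mul

/-- The toric ideal of the graph `G`. -/
def toricIdeal (G : SimpleGraph V) : Ideal (MvPolynomial G.edgeSet K) :=
  RingHom.ker (edgeHom K G)

/-- The graph obtained from `G` by deleting the first `i` edges of the sequence `e`
(the vertex set does not change). -/
def deleteFirst (G : SimpleGraph V) {k : ℕ} (e : Fin k → G.edgeSet) (i : ℕ) : SimpleGraph V :=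
  G.deleteEdges ((fun j => (e j : Sym2 V)) '' {j : Fin k | (j : ℕ) < i})

end Graph

end KMY

end

/-! If `G \ y` is bipartite, then `y` joins two vertices of one colour, since `G` is not bipartite.
Weights 1 and -1 on the two classes give `y` weight 2 and every other edge weight 0. So `I_G` is
homogeneous in the `y`-degree and closed under initial `y`-forms. As `I_G` is prime and omits `y`,
it contains every `qᵢ`; these are free of `y`, so elimination puts them in `N`. Thus `C = N`, which
is degenerate.

For connected `G`, delete all edges outside a spanning tree plus one odd-cycle edge; this subgraph
`H` has `|V|` edges. The height is `|E| - |V|`, by chains of primes above `I_G`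
(`height_toricIdeal_add_card_le`) and below it (`card_le_height_toricIdeal`). Both chains are strict
because the square of each vertex is a quotient of edge monomials (`exists_sq_mul_edgeHom`). The
upper bound applied to `H` gives `I_H = 0`. -/

noncomputable section

namespace KMY

/-! ### Spanning odd unicyclic subgraphs and edge deletions -/

section Combinatorics

variable {V : Type u}

/-- A connected non-bipartite graph contains a connected non-bipartite spanning subgraph with as
many edges as vertices: a spanning tree together with an edge closing an odd cycle. -/
theorem exists_spanning_odd_unicyclic [Finite V] {G : SimpleGraph V} (hc : G.Connected)
    (hG : ¬ G.IsBipartite) :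
    ∃ H ≤ G, H.Connected ∧ ¬ H.IsBipartite ∧ Nat.card H.edgeSet = Nat.card V := by
  classical
  have := Fintype.ofFinite V
  obtain ⟨T, hTG, hT⟩ := hc.exists_isTree_le
  have c : T.Coloring Bool := hT.isAcyclic.isBipartite.toColoring (by simp)
  obtain ⟨a, b, hab, hcab⟩ : ∃ a b, G.Adj a b ∧ c a = c b := by
    by_contra! h
    exact hG (SimpleGraph.Coloring.colorable (SimpleGraph.Coloring.mk c fun {a b} => h a b :
      G.Coloring Bool))
  have hT' : ¬ T.Adj a b := fun h => c.valid h hcab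
  refine ⟨T ⊔ SimpleGraph.edge a b, sup_le hTG ?_, hT.connected.mono le_sup_left, ?_, ?_⟩
  · rw [SimpleGraph.edge_le_iff]
    exact Or.inr hab
  -- The tree path from `a` to `b` is even because `c` agrees at its ends, so any 2-colouring of the
  -- larger graph would agree at the adjacent vertices `a` and `b`.
  · intro hb
    have c' : (T ⊔ SimpleGraph.edge a b).Coloring Bool := hb.toColoring (by simp)
    obtain ⟨p⟩ := hT.connected.preconnected a b
    have h1 := (c.even_length_iff_congr p).2 (by rw [hcab])
    have h2 := (c'.even_length_iff_congr (p.mapLe le_sup_left)).1 (by simpa using h1)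
    refine c'.valid (v := a) (w := b) ?_ (Bool.eq_iff_iff.2 h2)
    simp [SimpleGraph.edge_adj, hab.ne]
  · have h1 := hT.card_edgeFinset
    rw [Nat.card_eq_fintype_card (α := V), ← h1, SimpleGraph.edgeSet_sup,
      SimpleGraph.edgeSet_edge_of_ne hab.ne, Set.union_singleton, Nat.card_coe_set_eq,
      Set.ncard_insert_of_notMem (by simpa using hT'), Set.ncard_eq_toFinset_card',
      SimpleGraph.edgeFinset]

/-- Deleting the edges of `G` outside a spanning subgraph `H` one after the other. -/
theorem exists_deletion_sequence [Finite V] {G H : SimpleGraph V} (hHG : H ≤ G) :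
    ∃ (k : ℕ) (e : Fin k → G.edgeSet), Function.Injective e ∧
      (∀ i, H ≤ deleteFirst G e i) ∧ deleteFirst G e k = H ∧
      (∀ j, (e j : Sym2 V) ∉ H.edgeSet) ∧
      k + Nat.card H.edgeSet = Nat.card G.edgeSet := by
  let S : Set G.edgeSet := {e | (e : Sym2 V) ∉ H.edgeSet}
  let f : Fin (Nat.card S) ≃ S := (Finite.equivFin S).symm
  refine ⟨Nat.card S, fun j => f j, Subtype.val_injective.comp f.injective, fun i => ?_, ?_,
    fun j => (f j).2, ?_⟩
  · intro a b hab
    rw [deleteFirst, SimpleGraph.deleteEdges_adj]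
    refine ⟨hHG hab, ?_⟩
    rintro ⟨j, -, hj⟩
    exact (f j).2 (by rwa [← SimpleGraph.mem_edgeSet, ← hj] at hab)
  · ext a b
    rw [deleteFirst, SimpleGraph.deleteEdges_adj]
    refine ⟨fun ⟨hab, h⟩ => ?_, fun hab => ⟨hHG hab, ?_⟩⟩
    · by_contra hH
      refine h ⟨f.symm ⟨⟨s(a, b), hab⟩, hH⟩, Fin.is_lt _, ?_⟩
      change ((f (f.symm _) : G.edgeSet) : Sym2 V) = _
      rw [Equiv.apply_symm_apply]
    · rintro ⟨j, -, hj⟩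
      exact (f j).2 (by rwa [← SimpleGraph.mem_edgeSet, ← hj] at hab)
  · have h := Set.ncard_sdiff_add_ncard_of_subset (SimpleGraph.edgeSet_mono hHG)
    rw [Nat.card_coe_set_eq G.edgeSet, ← h, Nat.card_coe_set_eq, Nat.card_coe_set_eq,
      ← Set.ncard_image_of_injective S Subtype.val_injective]
    congr 2
    ext e
    simp [S, and_comm]

end Combinatorics

/-! ### Evaluations of edges and edge monomials -/

section EdgeEval

variable {K : Type v} [Field K] {V : Type u} (G : SimpleGraph V)

/-- The evaluation of polynomials in the edges of `G` that sends an edge `{a, b}` to `f a * f b`. -/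
def edgeEval {A : Type*} [CommRing A] [Algebra K A] (f : V → A) :
    MvPolynomial G.edgeSet K →ₐ[K] A :=
  aeval fun e : G.edgeSet => ((e : Sym2 V).map f).mul

variable {G} in
theorem edgeEval_X {A : Type*} [CommRing A] [Algebra K A] (f : V → A) {a b : V}
    (h : s(a, b) ∈ G.edgeSet) : edgeEval (K := K) G f (X ⟨s(a, b), h⟩) = f a * f b := by
  simp [edgeEval]

theorem edgeEval_X_ne_zero {A : Type*} [CommRing A] [IsDomain A] [Algebra K A] {f : V → A}
    (hf : ∀ v, f v ≠ 0) (e : G.edgeSet) : edgeEval (K := K) G f (X e) ≠ 0 := by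
  obtain ⟨e, he⟩ := e
  induction e with | _ a b =>
  rw [edgeEval_X]
  exact mul_ne_zero (hf a) (hf b)

theorem edgeEval_comp {A B : Type*} [CommRing A] [Algebra K A] [CommRing B] [Algebra K B]
    (g : A →ₐ[K] B) (f : V → A) :
    g.comp (edgeEval G f) = edgeEval (K := K) G fun v => g (f v) := by
  ext ⟨e, he⟩
  induction e with | _ a b =>
  simp [edgeEval_X]

theorem edgeHom_eq_edgeEval : edgeHom K G = edgeEval G X := rfl

variable (K) in
/-- The monomials of `K[E(G)]` that only involve edges of `H`. -/
def edgeMonomials (H : SimpleGraph V) : Submonoid (MvPolynomial G.edgeSet K) :=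
  Submonoid.closure (X '' {e | (e : Sym2 V) ∈ H.edgeSet})

variable {G}

theorem map_ne_zero_of_mem_edgeMonomials {H : SimpleGraph V} {A : Type*} [CommRing A] [IsDomain A]
    [Algebra K A] (g : MvPolynomial G.edgeSet K →ₐ[K] A)
    (hg : ∀ e : G.edgeSet, (e : Sym2 V) ∈ H.edgeSet → g (X e) ≠ 0)
    {p : MvPolynomial G.edgeSet K} (hp : p ∈ edgeMonomials K G H) : g p ≠ 0 := by
  induction hp using Submonoid.closure_induction with
  | mem _ h => obtain ⟨e, he, rfl⟩ := h; exact hg e he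
  | one => simp
  | mul _ _ _ _ h₁ h₂ => rw [map_mul]; exact mul_ne_zero h₁ h₂

theorem map_eq_of_mem_edgeMonomials {H : SimpleGraph V} {A : Type*} [CommRing A]
    [Algebra K A] {g g' : MvPolynomial G.edgeSet K →ₐ[K] A}
    (hg : ∀ e : G.edgeSet, (e : Sym2 V) ∈ H.edgeSet → g (X e) = g' (X e))
    {p : MvPolynomial G.edgeSet K} (hp : p ∈ edgeMonomials K G H) : g p = g' p := by
  induction hp using Submonoid.closure_induction with
  | mem _ h => obtain ⟨e, he, rfl⟩ := h; exact hg e he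
  | one => simp
  | mul _ _ _ _ h₁ h₂ => rw [map_mul, map_mul, h₁, h₂]

/-- In a connected non-bipartite graph `H`, the square of every vertex is a quotient of
edge monomials. -/
theorem exists_sq_mul_edgeHom {H : SimpleGraph V} (hHG : H ≤ G) (hc : H.Connected)
    (hH : ¬ H.IsBipartite) (x : V) :
    ∃ p ∈ edgeMonomials K G H, ∃ q ∈ edgeMonomials K G H,
      X x ^ 2 * edgeHom K G q = edgeHom K G p := by
  classical
  by_contra! hno
  have hX : ∀ {a b} (h : H.Adj a b), ∃ e ∈ edgeMonomials K G H, edgeHom K G e = X a * X b :=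
    fun {a b} h => ⟨X ⟨s(a, b), hHG h⟩, Submonoid.subset_closure ⟨_, h, rfl⟩, edgeEval_X _ _⟩
  let M := edgeMonomials K G H
  -- Modulo quotients of edge monomials, `P v` says `v = x` and `Q v` says `v = x⁻¹`. Crossing an
  -- edge swaps the two. If `x²` is not such a quotient, `P` is a proper 2-colouring.
  let P : V → Prop := fun v => ∃ p ∈ M, ∃ q ∈ M, X v * edgeHom K G q = X x * edgeHom K G p
  let Q : V → Prop := fun v => ∃ p ∈ M, ∃ q ∈ M, X v * X x * edgeHom K G q = edgeHom K G p
  have hPQ : ∀ v, P v ∨ Q v := by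
    intro v
    have := hc.preconnected x v
    rw [SimpleGraph.reachable_iff_reflTransGen] at this
    induction this with
    | refl => exact Or.inl ⟨1, one_mem _, 1, one_mem _, rfl⟩
    | tail _ hbc ih =>
      obtain ⟨e, he, hab⟩ := hX hbc
      rcases ih with ⟨p, hp, q, hq, h⟩ | ⟨p, hp, q, hq, h⟩
      · refine Or.inr ⟨e * q, mul_mem he hq, p, hp, ?_⟩
        rw [map_mul, hab]
        linear_combination (-X _) * h
      · refine Or.inl ⟨e * q, mul_mem he hq, p, hp, ?_⟩
        rw [map_mul, hab]
        linear_combination (-X _) * h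
  have hcol : ∀ {a b}, H.Adj a b → decide (P a) ≠ decide (P b) := by
    intro a b hadj hab
    obtain ⟨e, he, heab⟩ := hX hadj
    rw [decide_eq_decide] at hab
    by_cases ha : P a
    · obtain ⟨p', hp', q', hq', h'⟩ := hab.1 ha
      obtain ⟨p, hp, q, hq, h⟩ := ha
      refine hno (e * (q * q')) (mul_mem he (mul_mem hq hq')) (p * p') (mul_mem hp hp') ?_
      simp only [map_mul, heab]
      linear_combination (-(X x * edgeHom K G p')) * h - X a * edgeHom K G q * h'
    · obtain ⟨p, hp, q, hq, h⟩ := (hPQ a).resolve_left ha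
      obtain ⟨p', hp', q', hq', h'⟩ := (hPQ b).resolve_left (mt hab.2 ha)
      refine hno (p * p') (mul_mem hp hp') (e * (q * q')) (mul_mem he (mul_mem hq hq')) ?_
      simp only [map_mul, heab]
      linear_combination (edgeHom K G p') * h + X a * X x * edgeHom K G q * h'
  exact hH (SimpleGraph.Coloring.colorable (SimpleGraph.Coloring.mk (fun v => decide (P v)) hcol))

end EdgeEval

/-! ### The height of the toric ideal -/

section Height

variable {K : Type v} [Field K] {V : Type u} {G : SimpleGraph V}

instance isPrime_toricIdeal : (toricIdeal K G).IsPrime :=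
  RingHom.ker_isPrime _

variable (K) in
/-- The variables of `K[V]` with those in `W` replaced by `1`. -/
def specializedVar (W : Set V) (v : V) : MvPolynomial V K :=
  open Classical in if v ∈ W then 1 else X v

theorem specializedVar_of_mem {W : Set V} {v : V} (hv : v ∈ W) : specializedVar K W v = 1 :=
  if_pos hv

theorem specializedVar_of_notMem {W : Set V} {v : V} (hv : v ∉ W) : specializedVar K W v = X v :=
  if_neg hv

theorem specializedVar_ne_zero (W : Set V) (v : V) : specializedVar K W v ≠ 0 := by
  rw [specializedVar]
  split_ifs <;> simp

theorem aeval_specializedVar (U W : Set V) (v : V) :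
    aeval (specializedVar K U) (specializedVar K W v) = specializedVar K (U ∪ W) v := by
  by_cases h₁ : v ∈ W
  · rw [specializedVar_of_mem h₁, specializedVar_of_mem (Set.mem_union_right U h₁), map_one]
  · rw [specializedVar_of_notMem h₁, aeval_X]
    by_cases h₂ : v ∈ U
    · rw [specializedVar_of_mem h₂, specializedVar_of_mem (Set.mem_union_left W h₂)]
    · rw [specializedVar_of_notMem h₂, specializedVar_of_notMem (by simp [h₁, h₂])]

variable (K G) in
/-- The kernel of the evaluation that sends the vertices in `W` to `1`. -/
def specializedIdeal (W : Set V) : Ideal (MvPolynomial G.edgeSet K) :=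
  RingHom.ker (edgeEval (K := K) G (specializedVar K W))

instance (W : Set V) : (specializedIdeal K G W).IsPrime :=
  RingHom.ker_isPrime _

theorem specializedIdeal_empty : specializedIdeal K G ∅ = toricIdeal K G := by
  have h : specializedVar K (∅ : Set V) = X :=
    funext fun v => specializedVar_of_notMem (Set.notMem_empty v)
  rw [specializedIdeal, h]
  rfl

/-- Write `x² = p / q` with edge monomials `p`, `q`. Then `p - q` vanishes once `x` is set to 1, but
not while `x` is still a variable. -/
theorem specializedIdeal_lt_insert (hc : G.Connected) (hG : ¬ G.IsBipartite) {W : Set V} {x : V}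
    (hx : x ∉ W) : specializedIdeal K G W < specializedIdeal K G (insert x W) := by
  have hcomp : ∀ (U : Set V) (p : MvPolynomial G.edgeSet K),
      edgeEval G (specializedVar K U) p = aeval (specializedVar K U) (edgeHom K G p) := by
    intro U p
    rw [← AlgHom.comp_apply, edgeHom_eq_edgeEval, edgeEval_comp]
    simp only [aeval_X]
  refine lt_of_le_of_ne ?_ fun heq => ?_
  · intro p hp
    have h := edgeEval_comp (K := K) G (aeval (specializedVar K {x})) (specializedVar K W)
    simp only [aeval_specializedVar, Set.singleton_union] at h
    rw [specializedIdeal, RingHom.mem_ker] at hp ⊢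
    rw [← h, AlgHom.comp_apply, hp, map_zero]
  · obtain ⟨p, -, q, hq, h⟩ := exists_sq_mul_edgeHom (K := K) le_rfl hc hG x
    have h₁ : p - q ∈ specializedIdeal K G (insert x W) := by
      rw [specializedIdeal, RingHom.mem_ker, map_sub, sub_eq_zero, hcomp, hcomp, ← h, map_mul,
        map_pow, aeval_X, specializedVar_of_mem (Set.mem_insert _ _), one_pow, one_mul]
    rw [← heq, specializedIdeal, RingHom.mem_ker, map_sub, sub_eq_zero] at h₁
    have hq0 := map_ne_zero_of_mem_edgeMonomials (edgeEval G (specializedVar K W))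
      (fun e _ => edgeEval_X_ne_zero G (specializedVar_ne_zero W) e) hq
    have h₂ := hcomp W p
    rw [h₁, ← h, map_mul, map_pow, aeval_X, specializedVar_of_notMem hx, ← hcomp] at h₂
    have h₃ : (X x : MvPolynomial V K) ^ 2 = 1 :=
      mul_right_cancel₀ hq0 (by rw [← h₂, one_mul])
    simpa using congrArg (eval fun _ => (0 : K)) h₃

/-- Setting the vertices to 1 one at a time gives `|V|` strict inclusions of primes above `I_G`, in
a ring of dimension `|E|`. -/
theorem height_toricIdeal_add_card_le [Finite V] (hc : G.Connected) (hG : ¬ G.IsBipartite) :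
    (toricIdeal K G).height + Nat.card V ≤ Nat.card G.edgeSet := by
  classical
  have := Fintype.ofFinite V
  have hchain : ∀ W : Finset V,
      (toricIdeal K G).height + W.card ≤ (specializedIdeal K G (W : Set V)).height := by
    intro W
    induction W using Finset.induction_on with
    | empty => simp [specializedIdeal_empty]
    | insert x W hx ih =>
      rw [Finset.card_insert_of_notMem hx, Finset.coe_insert, Nat.cast_add, Nat.cast_one,
        ← add_assoc]
      exact (add_le_add_left ih 1).trans (Ideal.height_add_one_le_of_lt_of_isPrime
        (specializedIdeal_lt_insert hc hG (by simpa using hx)))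
  have h := hchain Finset.univ
  rw [Finset.card_univ, ← Nat.card_eq_fintype_card] at h
  refine h.trans ?_
  have hdim := Ideal.height_le_ringKrullDim_of_isPrime
    (I := specializedIdeal K G ((Finset.univ : Finset V) : Set V))
  rw [MvPolynomial.ringKrullDim_of_isNoetherianRing, ringKrullDim_eq_zero_of_field, zero_add]
    at hdim
  exact_mod_cast hdim

variable (K G) in
/-- The evaluation that sends an edge of `S` to a variable of its own, and an edge `{a, b}` outside
of `S` to `a * b`. -/
def partialEval (S : Set G.edgeSet) :
    MvPolynomial G.edgeSet K →ₐ[K] MvPolynomial (G.edgeSet ⊕ V) K :=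
  open Classical in
  aeval fun e => if e ∈ S then X (Sum.inl e) else edgeEval (K := K) G (fun v => X (Sum.inr v)) (X e)

theorem partialEval_X_of_mem {S : Set G.edgeSet} {e : G.edgeSet} (he : e ∈ S) :
    partialEval K G S (X e) = X (Sum.inl e) := by
  simp [partialEval, he]

theorem partialEval_X_of_notMem {S : Set G.edgeSet} {e : G.edgeSet} (he : e ∉ S) :
    partialEval K G S (X e) = edgeEval (K := K) G (fun v => X (Sum.inr v)) (X e) := by
  simp [partialEval, he]

theorem ker_partialEval_empty : RingHom.ker (partialEval K G ∅) = toricIdeal K G := by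
  have h : partialEval K G ∅ = (rename Sum.inr).comp (edgeHom K G) := by
    rw [edgeHom_eq_edgeEval, edgeEval_comp]
    ext1 e
    simp [partialEval_X_of_notMem]
  ext p
  rw [toricIdeal, RingHom.mem_ker, RingHom.mem_ker, h, AlgHom.comp_apply,
    map_eq_zero_iff _ (rename_injective _ Sum.inr_injective)]

/-- For `e = {a, b}` with `a² = p / q` and `b² = p' / q'` over `H`, the binomial `e² q q' - p p'` is
a relation that is lost when `e` becomes a free variable. -/
theorem ker_partialEval_insert_lt {H : SimpleGraph V} (hHG : H ≤ G) (hc : H.Connected)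
    (hH : ¬ H.IsBipartite) {S : Set G.edgeSet} {e : G.edgeSet} (heS : e ∉ S)
    (hS : ∀ e' ∈ insert e S, (e' : Sym2 V) ∉ H.edgeSet) :
    RingHom.ker (partialEval K G (insert e S)) < RingHom.ker (partialEval K G S) := by
  classical
  have hrename : ∀ U : Set G.edgeSet, (∀ e' ∈ U, (e' : Sym2 V) ∉ H.edgeSet) →
      ∀ p ∈ edgeMonomials K G H, partialEval K G U p = rename Sum.inr (edgeHom K G p) := by
    intro U hU p hp
    rw [← AlgHom.comp_apply, edgeHom_eq_edgeEval, edgeEval_comp]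
    refine map_eq_of_mem_edgeMonomials (fun e' he' => ?_) hp
    rw [partialEval_X_of_notMem fun h => hU e' h he']
    simp
  have hS' : ∀ e' ∈ S, (e' : Sym2 V) ∉ H.edgeSet := fun e' h => hS e' (Set.mem_insert_of_mem _ h)
  refine lt_of_le_of_ne ?_ fun heq => ?_
  -- `s` puts `a * b` back for the free variable of `e = {a, b}`.
  · let s : MvPolynomial (G.edgeSet ⊕ V) K →ₐ[K] MvPolynomial (G.edgeSet ⊕ V) K :=
      aeval (Sum.elim (fun e' => if e' = e then edgeEval (K := K) G (fun v => X (Sum.inr v)) (X e)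
        else X (Sum.inl e')) fun v => X (Sum.inr v))
    have h : partialEval K G S = s.comp (partialEval K G (insert e S)) := by
      ext1 e'
      rw [AlgHom.comp_apply]
      by_cases h₁ : e' = e
      · subst h₁
        rw [partialEval_X_of_mem (Set.mem_insert _ _), partialEval_X_of_notMem heS]
        simp [s]
      · by_cases h₂ : e' ∈ S
        · rw [partialEval_X_of_mem h₂, partialEval_X_of_mem (Set.mem_insert_of_mem _ h₂)]
          simp [s, h₁]
        · rw [partialEval_X_of_notMem h₂, partialEval_X_of_notMem (by simp [h₁, h₂]),
            ← AlgHom.comp_apply, edgeEval_comp]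
          simp [s]
    intro p hp
    rw [RingHom.mem_ker] at hp ⊢
    rw [h, AlgHom.comp_apply, hp, map_zero]
  · obtain ⟨⟨a, b⟩, hab⟩ : ∃ ab : V × V, s(ab.1, ab.2) = (e : Sym2 V) := Quot.exists_rep _
    obtain ⟨p, hp, q, hq, h⟩ := exists_sq_mul_edgeHom (K := K) hHG hc hH a
    obtain ⟨p', hp', q', hq', h'⟩ := exists_sq_mul_edgeHom (K := K) hHG hc hH b
    have heX : edgeEval (K := K) G (fun v => (X (Sum.inr v) : MvPolynomial (G.edgeSet ⊕ V) K)) (X e)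
        = X (Sum.inr a) * X (Sum.inr b) := by
      obtain ⟨e, he⟩ := e
      subst hab
      exact edgeEval_X _ _
    have h₁ : X e ^ 2 * (q * q') - p * p' ∈ RingHom.ker (partialEval K G S) := by
      rw [RingHom.mem_ker, map_sub, map_mul, map_pow, partialEval_X_of_notMem heS, heX,
        hrename S hS' _ (mul_mem hq hq'), hrename S hS' _ (mul_mem hp hp'), map_mul (edgeHom K G),
        map_mul (edgeHom K G) p, ← h, ← h']
      simp only [map_mul, map_pow, rename_X]
      ring
    rw [← heq, RingHom.mem_ker, map_sub, map_mul, map_pow,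
      partialEval_X_of_mem (Set.mem_insert _ _), hrename _ hS _ (mul_mem hq hq'),
      hrename _ hS _ (mul_mem hp hp')] at h₁
    -- Setting the free edge variables to 0 leaves `-p p'`, which is nonzero.
    have h₂ := congrArg (aeval (Sum.elim (fun _ => 0) (X : V → MvPolynomial V K))) h₁
    rw [map_zero, map_sub, map_mul, map_pow, aeval_X, aeval_rename, aeval_rename] at h₂
    simp only [Sum.elim_inl, ne_eq, OfNat.ofNat_ne_zero, not_false_eq_true, zero_pow, zero_mul,
      zero_sub, neg_eq_zero, Sum.elim_comp_inr, aeval_X_left, AlgHom.coe_id, id_eq] at h₂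
    exact map_ne_zero_of_mem_edgeMonomials (edgeHom K G)
      (fun e' _ => edgeEval_X_ne_zero G X_ne_zero e') (mul_mem hp hp') h₂

theorem card_le_height_toricIdeal {H : SimpleGraph V} (hHG : H ≤ G) (hc : H.Connected)
    (hH : ¬ H.IsBipartite) (S : Finset G.edgeSet) (hS : ∀ e ∈ S, (e : Sym2 V) ∉ H.edgeSet) :
    (S.card : ℕ∞) ≤ (toricIdeal K G).height := by
  classical
  have hprime : ∀ U : Set G.edgeSet, (RingHom.ker (partialEval K G U)).IsPrime :=
    fun U => RingHom.ker_isPrime _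
  -- Keeping the height of the last kernel in the bound lets the induction extend the chain
  -- downwards.
  suffices h : S.card + (RingHom.ker (partialEval K G S)).height ≤ (toricIdeal K G).height from
    le_self_add.trans h
  induction S using Finset.induction_on with
  | empty => simp [ker_partialEval_empty]
  | insert e S he ih =>
    have := hprime S
    have := hprime (insert e S)
    rw [Finset.card_insert_of_notMem he, Finset.coe_insert, Nat.cast_add, Nat.cast_one, add_assoc,
      add_comm 1]
    exact (add_le_add_right (Ideal.height_add_one_le_of_lt_of_isPrime
      (ker_partialEval_insert_lt hHG hc hH (by simpa using he) (by simpa using hS))) _).trans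
      (ih fun e' h => hS e' (Finset.mem_insert_of_mem h))

end Height

/-! ### Initial forms, elimination and degeneracy -/

section InitForm

variable {K : Type v} [Field K] {σ : Type u}

theorem coeff_initForm (y : σ) (f : MvPolynomial σ K) (a : σ →₀ ℕ) :
    (initForm y f).coeff a = if a y = f.degreeOf y then f.coeff a else 0 := by
  classical
  simp only [initForm, coeff_sum, coeff_monomial, Finset.sum_ite_eq', Finset.mem_filter,
    mem_support_iff]
  split_ifs <;> simp_all

theorem initForm_eq_self {y : σ} {f : MvPolynomial σ K} (hf : f.degreeOf y = 0) :
    initForm y f = f := by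
  ext a
  rw [coeff_initForm, hf]
  split_ifs with h
  · rfl
  · by_contra hne
    exact h (Nat.le_zero.1 (hf ▸ monomial_le_degreeOf y (mem_support_iff.2 (Ne.symm hne))))

/-- All exponents `a` of `q` satisfy `d + a y = f.degreeOf y`, and some `a` has `a y = 0` because
`y` does not divide `q`. -/
theorem degreeOf_initForm_cofactor {y : σ} {f q : MvPolynomial σ K} {d : ℕ} (hq : ¬ X y ∣ q)
    (h : initForm y f = X y ^ d * q) : f.degreeOf y = d ∧ q.degreeOf y = 0 := by
  classical
  have hsupp : ∀ a, q.coeff a ≠ 0 → d + a y = f.degreeOf y := by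
    intro a ha
    have h₁ : (initForm y f).coeff (Finsupp.single y d + a) ≠ 0 := by
      rwa [h, X_pow_eq_monomial, coeff_monomial_mul, one_mul]
    rw [coeff_initForm] at h₁
    by_contra hne
    exact h₁ (if_neg (by simpa using hne))
  obtain ⟨a, ha, hay⟩ : ∃ a, q.coeff a ≠ 0 ∧ a y = 0 := by
    by_contra! hno
    refine hq (X_dvd_iff_modMonomial_eq_zero.2 ?_)
    ext a
    by_cases hle : Finsupp.single y 1 ≤ a
    · rw [coeff_modMonomial_of_le _ hle, coeff_zero]
    · rw [coeff_modMonomial_of_not_le _ hle, coeff_zero]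
      by_contra hne
      exact hle (by simpa [Nat.one_le_iff_ne_zero] using hno a hne)
  have hd := hsupp a ha
  rw [hay, add_zero] at hd
  refine ⟨hd.symm, Nat.le_zero.1 (degreeOf_le_iff.2 fun b hb => ?_)⟩
  have := hsupp b (mem_support_iff.1 hb)
  omega

namespace Decomposition

variable {m : MonomialOrder.{u, w} σ} {y : σ} {I : Ideal (MvPolynomial σ K)}
  (D : Decomposition m y I)

theorem exists_degree_le {f : MvPolynomial σ K} (hf : f ∈ I) (hf0 : f ≠ 0) :
    ∃ i, m.degree (X y ^ D.d i * D.q i + D.r i) ≤ m.degree f := by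
  classical
  have hmem : m.leadingTerm f ∈
      Ideal.span (Set.range fun i => m.leadingTerm (X y ^ D.d i * D.q i + D.r i)) := by
    rw [D.groebner.2]
    exact Ideal.subset_span ⟨f, hf, rfl⟩
  have hspan : Ideal.span (Set.range fun i => m.leadingTerm (X y ^ D.d i * D.q i + D.r i)) ≤
      Ideal.span ((fun s => monomial s (1 : K)) ''
        Set.range fun i => m.degree (X y ^ D.d i * D.q i + D.r i)) := by
    rw [Ideal.span_le]
    rintro _ ⟨i, rfl⟩
    change m.leadingTerm _ ∈ Ideal.span _
    rw [← MonomialOrder.C_mul_leadingCoeff_monomial_degree]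
    exact Ideal.mul_mem_left _ _ (Ideal.subset_span ⟨_, ⟨i, rfl⟩, rfl⟩)
  obtain ⟨_, ⟨i, rfl⟩, hi⟩ := mem_ideal_span_monomial_image.1 (hspan hmem) (m.degree f)
    (by rw [m.support_leadingTerm' hf0]; exact Finset.mem_singleton_self _)
  exact ⟨i, hi⟩

theorem le_degree_apply (i : Fin D.size) :
    D.d i ≤ m.degree (X y ^ D.d i * D.q i + D.r i) y := by
  have hq : D.q i ≠ 0 := fun h => D.not_dvd i (h ▸ dvd_zero _)
  rw [← MonomialOrder.degree_leadingTerm, D.compatible, D.initForm_eq,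
    MonomialOrder.degree_leadingTerm, m.degree_mul (pow_ne_zero _ (X_ne_zero y)) hq,
    X_pow_eq_monomial]
  classical
  simp [MonomialOrder.degree_monomial]

/-- Elimination: the elements of `I` that do not involve `y` lie in `N`. -/
theorem mem_idealN {f : MvPolynomial σ K} (hf : f ∈ I) (hfy : f.degreeOf y = 0) :
    f ∈ D.idealN := by
  classical
  induction hs : m.toSyn (m.degree f) using WellFoundedLT.induction generalizing f with
  | ind s ih =>
  by_cases hf0 : f = 0
  · rw [hf0]
    exact zero_mem _
  obtain ⟨i, hi⟩ := D.exists_degree_le hf hf0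
  set g := X y ^ D.d i * D.q i + D.r i with hg
  -- The leading exponent of `f` has no `y`, so a generator whose leading monomial divides it has
  -- `dᵢ = 0`.
  have hdi : D.d i = 0 := by
    have h₁ := (D.le_degree_apply i).trans (hi y)
    have h₂ := monomial_le_degreeOf y (m.degree_mem_support hf0)
    omega
  have hgy : g.degreeOf y = 0 :=
    (degreeOf_initForm_cofactor (D.not_dvd i) (D.initForm_eq i)).1.trans hdi
  have hgq : g = D.q i := by
    rw [← initForm_eq_self hgy, hg, D.initForm_eq i, hdi, pow_zero, one_mul]
  have hgN : g ∈ D.idealN := hgq ▸ Ideal.subset_span ⟨i, hdi, rfl⟩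
  have hg0 : g ≠ 0 := by
    rw [hgq]
    exact fun h => D.not_dvd i (h ▸ dvd_zero _)
  have hunit : IsUnit (m.leadingCoeff g) :=
    isUnit_iff_ne_zero.2 (m.leadingCoeff_ne_zero_iff.2 hg0)
  by_cases hdeg : m.degree f = 0
  -- Reduction lowers the degree only when it is nonzero. Here `g` is a nonzero constant, so `N` is
  -- the unit ideal.
  · have hgdeg : m.degree g = 0 := le_antisymm (hdeg ▸ hi) zero_le
    rw [MonomialOrder.eq_C_of_degree_eq_zero hgdeg] at hgN
    rw [Ideal.eq_top_of_isUnit_mem _ hgN (hunit.map C)]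
    exact Submodule.mem_top
  · set c : MvPolynomial σ K :=
      monomial (m.degree f - m.degree g) (hunit.unit⁻¹ * m.leadingCoeff f) with hc
    have hred : m.reduce hunit f = f - c * g := rfl
    have hlt := MonomialOrder.degree_reduce_lt hunit hi hdeg
    have hcy : c.degreeOf y = 0 := by
      have h₂ := monomial_le_degreeOf y (m.degree_mem_support hf0)
      refine Nat.le_zero.1 (degreeOf_le_iff.2 fun b hb => ?_)
      rw [Finset.mem_singleton.1 (support_monomial_subset hb), Finsupp.tsub_apply]
      omega
    rw [hred] at hlt
    have h := ih _ (hs ▸ hlt) (sub_mem hf (Ideal.mul_mem_left _ c (D.groebner.1 i))) ?_ rfl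
    · rw [← sub_add_cancel f (c * g)]
      exact add_mem h (Ideal.mul_mem_left _ c hgN)
    · have h₁ := degreeOf_sub_le y f (c * g)
      have h₂ := degreeOf_mul_le y c g
      have h₃ : (c * g).degreeOf y = 0 := by omega
      rw [hfy, h₃] at h₁
      exact Nat.le_zero.1 h₁

/-- If `I` is prime, does not contain `y`, and is closed under taking initial `y`-forms, then every
decomposition is degenerate. -/
theorem isDegenerate_of_initForm_mem [I.IsPrime] (hy : X y ∉ I)
    (hI : ∀ f ∈ I, initForm y f ∈ I) : D.IsDegenerate := by
  refine Or.inl (congrArg _ (le_antisymm ?_ (Ideal.span_mono (Set.image_subset_range _ _))))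
  rw [idealC, Ideal.span_le]
  rintro _ ⟨i, rfl⟩
  have h := hI _ (D.groebner.1 i)
  rw [D.initForm_eq] at h
  refine D.mem_idealN ?_ (degreeOf_initForm_cofactor (D.not_dvd i) (D.initForm_eq i)).2
  exact (Ideal.IsPrime.mem_or_mem ‹_› h).resolve_left fun h' =>
    hy (Ideal.IsPrime.mem_of_pow_mem ‹_› _ h')

end Decomposition

end InitForm

/-! ### The grading when `G \ y` is bipartite -/

section BipartiteDeletion

variable {K : Type v} [Field K] {V : Type u} {G : SimpleGraph V}

theorem X_notMem_toricIdeal (e : G.edgeSet) : X e ∉ toricIdeal K G :=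
  edgeEval_X_ne_zero G X_ne_zero e

/-- `Multiplicative` makes `Sym2.mul` add the weights of the two ends. -/
theorem exists_weight (hG : ¬ G.IsBipartite) (y : G.edgeSet)
    (hy : (G.deleteEdges {(y : Sym2 V)}).IsBipartite) :
    ∃ w : V → ℤ, ∀ e : G.edgeSet, ∃ n,
      ((e : Sym2 V).map fun v => Multiplicative.ofAdd (w v)).mul = Multiplicative.ofAdd n ∧
        (e = y → n = 2) ∧ (e ≠ y → n = 0) := by
  classical
  obtain ⟨y, hyG⟩ := y
  induction y with | _ a b =>
  have c : (G.deleteEdges {s(a, b)}).Coloring Bool := SimpleGraph.Colorable.toColoring hy (by simp)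
  have hc : ∀ {u v}, G.Adj u v → s(u, v) ≠ s(a, b) → c u ≠ c v := fun {u v} h hne =>
    c.valid (by rw [SimpleGraph.deleteEdges_adj]; exact ⟨h, hne⟩)
  have hab : c a = c b := by
    by_contra hne
    refine hG (SimpleGraph.Coloring.colorable (SimpleGraph.Coloring.mk c fun {u v} h => ?_ :
      G.Coloring Bool))
    by_cases heq : s(u, v) = s(a, b)
    · rcases Sym2.eq_iff.1 heq with ⟨rfl, rfl⟩ | ⟨rfl, rfl⟩
      exacts [hne, Ne.symm hne]
    · exact hc h heq
  refine ⟨fun v => if c v = c a then 1 else -1, ?_⟩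
  rintro ⟨e, he⟩
  induction e with | _ u v =>
  refine ⟨(if c u = c a then 1 else -1) + (if c v = c a then 1 else -1), rfl,
    fun heq => ?_, fun hne => ?_⟩
  · rcases Sym2.eq_iff.1 (Subtype.mk.inj heq) with ⟨rfl, rfl⟩ | ⟨rfl, rfl⟩ <;> simp [hab]
  · have := hc he fun h => hne (Subtype.ext h)
    cases hu : c u <;> cases hv : c v <;> cases ha : c a <;> simp_all

/-- The edge map sends `y`-degree `n` to weight `2 * n`, so the image of the initial form is a
weighted component of the image of `f`, which is 0. -/
theorem initForm_mem_toricIdeal (hG : ¬ G.IsBipartite) (y : G.edgeSet)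
    (hy : (G.deleteEdges {(y : Sym2 V)}).IsBipartite) {f : MvPolynomial G.edgeSet K}
    (hf : f ∈ toricIdeal K G) : initForm y f ∈ toricIdeal K G := by
  classical
  obtain ⟨w, hw⟩ := exists_weight hG y hy
  have hX : ∀ e : G.edgeSet,
      IsWeightedHomogeneous w (edgeHom K G (X e)) (if e = y then 2 else 0) := by
    intro e
    obtain ⟨n, he, hey, hey'⟩ := hw e
    obtain ⟨⟨a, b⟩, hab⟩ : ∃ ab : V × V, s(ab.1, ab.2) = (e : Sym2 V) := Quot.exists_rep _
    rw [← hab, Sym2.map_mk, Sym2.mul_mk, ← ofAdd_add] at he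
    have hn : (if e = y then 2 else 0) = w a + w b := by
      rw [Multiplicative.ofAdd.injective he]
      split_ifs with h
      exacts [(hey h).symm, (hey' h).symm]
    rw [hn, edgeHom, aeval_X, ← hab]
    exact (isWeightedHomogeneous_X K w a).mul (isWeightedHomogeneous_X K w b)
  have hmon : ∀ (a : G.edgeSet →₀ ℕ) (c : K),
      IsWeightedHomogeneous w (edgeHom K G (monomial a c)) (2 * (a y : ℤ)) := by
    intro a c
    rw [monomial_eq, map_mul, ← algebraMap_eq, AlgHom.commutes, Finsupp.prod, map_prod]
    refine IsWeightedHomogeneous.C_mul ?_ c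
    have h := IsWeightedHomogeneous.prod a.support (fun e => edgeHom K G (X e ^ a e)) _
      fun e _ => by rw [map_pow]; exact (hX e).pow (a e)
    convert h using 1
    simp [mul_comm]
  have h : edgeHom K G (initForm y f) =
      weightedHomogeneousComponent w (2 * (f.degreeOf y : ℤ)) (edgeHom K G f) := by
    conv_rhs => enter [2]; rw [f.as_sum, map_sum]
    rw [map_sum]
    rw [initForm, map_sum, Finset.sum_filter]
    refine Finset.sum_congr rfl fun a _ => ?_
    split_ifs with ha
    · rw [← ha, (hmon a _).weightedHomogeneousComponent_same]
    · rw [(hmon a _).weightedHomogeneousComponent_ne]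
      omega
  rw [toricIdeal, RingHom.mem_ker] at hf ⊢
  rw [h, hf, map_zero]

end BipartiteDeletion

end KMY
end

theorem mainTheorem2 {K : Type v} [Field K] {V : Type u} [Finite V]
    (G : SimpleGraph V) (hG : ¬ G.IsBipartite) (y : G.edgeSet)
    (m : MonomialOrder.{u, w} G.edgeSet)
    (D : KMY.Decomposition m y (KMY.toricIdeal K G)) (hD : D.IsNondegenerate) :
    ¬ (G.deleteEdges {(y : Sym2 V)}).IsBipartite ∧
    (G.Connected →
      ∃ (k : ℕ) (e : Fin k → G.edgeSet),
        Function.Injective e ∧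
        (∀ i : ℕ, 1 ≤ i → i ≤ k →
          (KMY.deleteFirst G e i).Connected ∧ ¬ (KMY.deleteFirst G e i).IsBipartite) ∧
        KMY.toricIdeal K (KMY.deleteFirst G e k) = ⊥ ∧
        (KMY.toricIdeal K G).height = (k : ℕ∞)) := by
  refine ⟨fun hy => hD (D.isDegenerate_of_initForm_mem (KMY.X_notMem_toricIdeal y) fun f =>
    KMY.initForm_mem_toricIdeal hG y hy), fun hc => ?_⟩
  obtain ⟨H, hHG, hHc, hH, hcard⟩ := KMY.exists_spanning_odd_unicyclic hc hG
  obtain ⟨k, e, he, hle, hlast, hnot, hk⟩ := KMY.exists_deletion_sequence hHG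
  refine ⟨k, e, he, fun i _ _ => ⟨hHc.mono (hle i), fun h => hH (h.mono_left (hle i))⟩, ?_, ?_⟩
  -- `H` has `|V|` edges, so the upper bound for `H` forces height 0.
  · rw [hlast, ← Ideal.height_eq_zero_iff_eq_bot]
    have h := KMY.height_toricIdeal_add_card_le (K := K) hHc hH
    rw [hcard] at h
    exact nonpos_iff_eq_zero.1
      ((ENat.add_le_add_iff_right (ENat.natCast_ne_top _)).1 (h.trans_eq (zero_add _).symm))
  · have hlower := KMY.card_le_height_toricIdeal (K := K) hHG hHc hH
      (Finset.univ.map ⟨e, he⟩) (by simpa using hnot)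
    rw [Finset.card_map, Finset.card_univ, Fintype.card_fin] at hlower
    have hupper := KMY.height_toricIdeal_add_card_le (K := K) hc hG
    rw [← hk, hcard, Nat.cast_add] at hupper
    exact le_antisymm ((ENat.add_le_add_iff_right (ENat.natCast_ne_top _)).1 hupper) hlower
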